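/- Let $m, N \ge 0$ be integers and let $R = (R^{ij}_{kl})_{1\le i,j,k,l\le m}$ be a complex $R$-matrix: as a linear operator on $\mathbb{C}^m\otimes\mathbb{C}^m$, $R(v_k\otimes v_l)=\sum_{i,j}R^{ij}_{kl}\,v_i\otimes v_j$, it satisfies $R^2=\mathbb{1}$ and the Yang–Baxter equation $R_{12}R_{23}R_{12}=R_{23}R_{12}R_{23}$ on $(\mathbb{C}^m)^{\otimes 3}$. Let $\mathcal{X}_{R,N}$ be the unital associative $\mathbb{C}$-algebra generated by $\{\psi^{\pm}_{a,i} \mid 1\le a\le N,\ 1\le i\le m\}$ subject to the relations, for all modes $a,b$ and all $i,j$, $$\psi^-_{a,i}\psi^+_{b,j}=\sum_{k,l}R^{ik}_{jl}\,\psi^+_{b,k}\psi^-_{a,l}+\delta_{ab}\delta_{ij},\qquad \psi^+_{a,i}\psi^+_{b,j}=\sum_{k,l}R^{kl}_{ij}\,\psi^+_{b,k}\psi^+_{a,l},\qquad \psi^-_{a,i}\psi^-_{b,j}=\sum_{k,l}R^{ji}_{lk}\,\psi^-_{b,k}\psi^-_{a,l},$$ and let $\mathcal{X}_R=\mathcal{X}_{R,1}$,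 with generators $\psi^\pm_i$. Then: 1. There is an isomorphism of complex vector spaces $\mathcal{X}_{R,N}\cong\mathcal{X}_R^{\otimes N}$. 2. For every mode $a\in\{1,\dots,N\}$, the assignment $\psi^\pm_i\mapsto\psi^\pm_{a,i}$ ($1\le i\le m$) extends to an isomorphism of unital algebras from $\mathcal{X}_R$ onto the unital subalgebra of $\mathcal{X}_{R,N}$ generated by $\{\psi^\pm_{a,i}\mid 1\le i\le m\}$; that is, the relations involving other modes impose no additional relations on the operators of mode $a$. -/

import Mathlib

open scoped TensorProduct

namespace Para

/-- The entry `R (i, j) (k, l)` is the tensor component with upper indices `i j` and lower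
indices `k l`, so that `R (v_k ⊗ v_l) = ∑ i j, R (i, j) (k, l) • v_i ⊗ v_j`. -/
abbrev Tensor4 (m : ℕ) : Type := Matrix (Fin m × Fin m) (Fin m × Fin m) ℂ

/-- `R` acting on the first two factors of the threefold tensor power. -/
def R12 {m : ℕ} (R : Tensor4 m) :
    Matrix (Fin m × Fin m × Fin m) (Fin m × Fin m × Fin m) ℂ :=
  fun x y => if x.2.2 = y.2.2 then R (x.1, x.2.1) (y.1, y.2.1) else 0

/-- `R` acting on the last two factors of the threefold tensor power. -/
def R23 {m : ℕ} (R : Tensor4 m) :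
    Matrix (Fin m × Fin m × Fin m) (Fin m × Fin m × Fin m) ℂ :=
  fun x y => if x.1 = y.1 then R x.2 y.2 else 0

/-- An `R`-matrix: an involutive solution of the (constant, braid form) Yang-Baxter equation. -/
structure IsRMatrix {m : ℕ} (R : Tensor4 m) : Prop where
  involutive : R * R = 1
  yangBaxter : R12 R * R23 R * R12 R = R23 R * R12 R * R23 R

/-- The generators: `create a i` is the creation operator and `annihilate a i` the annihilation
operator of mode `a` with internal index `i`. -/
inductive Gen (N m : ℕ) : Type
  | create (a : Fin N) (i : Fin m) : Gen N m
  | annihilate (a : Fin N) (i : Fin m) : Gen N m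

/-- The free creation operator. -/
def fc {N m : ℕ} (a : Fin N) (i : Fin m) : FreeAlgebra ℂ (Gen N m) :=
  FreeAlgebra.ι ℂ (Gen.create a i)

/-- The free annihilation operator. -/
def fa {N m : ℕ} (a : Fin N) (i : Fin m) : FreeAlgebra ℂ (Gen N m) :=
  FreeAlgebra.ι ℂ (Gen.annihilate a i)

/-- The parastatistical commutation relations between all modes. -/
inductive CommRel {m : ℕ} (R : Tensor4 m) (N : ℕ) :
    FreeAlgebra ℂ (Gen N m) → FreeAlgebra ℂ (Gen N m) → Prop
  | annihilate_create (a b : Fin N) (i j : Fin m) :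
      CommRel R N (fa a i * fc b j)
        (∑ k : Fin m, ∑ l : Fin m, R (i, k) (j, l) • (fc b k * fa a l)
          + (if a = b ∧ i = j then 1 else 0))
  | create_create (a b : Fin N) (i j : Fin m) :
      CommRel R N (fc a i * fc b j)
        (∑ k : Fin m, ∑ l : Fin m, R (k, l) (i, j) • (fc b k * fc a l))
  | annihilate_annihilate (a b : Fin N) (i j : Fin m) :
      CommRel R N (fa a i * fa b j)
        (∑ k : Fin m, ∑ l : Fin m, R (j, i) (l, k) • (fa b k * fa a l))

/-- The unital associative complex algebra `X_{R,N}` on the creation and annihilation operators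
of `N` modes, modulo the commutation relations. -/
abbrev XN {m : ℕ} (R : Tensor4 m) (N : ℕ) : Type := RingQuot (CommRel R N)

/-- The single-mode algebra `X_R = X_{R,1}`. -/
abbrev X {m : ℕ} (R : Tensor4 m) : Type := XN R 1

/-- The creation operator `ψ⁺_{a,i}` in `X_{R,N}`. -/
def create {m : ℕ} (R : Tensor4 m) {N : ℕ} (a : Fin N) (i : Fin m) : XN R N :=
  RingQuot.mkAlgHom ℂ (CommRel R N) (fc a i)

/-- The annihilation operator `ψ⁻_{a,i}` in `X_{R,N}`. -/
def annihilate {m : ℕ} (R : Tensor4 m) {N : ℕ} (a : Fin N) (i : Fin m) : XN R N :=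
  RingQuot.mkAlgHom ℂ (CommRel R N) (fa a i)

/-- The unital subalgebra of `X_{R,N}` generated by the operators of the single mode `a`. -/
def modeSubalgebra {m : ℕ} (R : Tensor4 m) {N : ℕ} (a : Fin N) : Subalgebra ℂ (XN R N) :=
  Algebra.adjoin ℂ (Set.range (create R a) ∪ Set.range (annihilate R a))

end Para

/-! The theorem is a Poincaré–Birkhoff–Witt statement: every element has a unique normally ordered
form. Creation operators alone form the quadratic algebra `ModeAlg R (Fin N)`, annihilation
operators form `ModeAlg (dual R) (Fin N)`, and multiplication identifies `XN R N` with the tensor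
product of the two (`normalOrder_bijective`). Likewise `ModeAlg S (α ⊕ β)` is the ordered product of
`ModeAlg S α` and `ModeAlg S β` (`orderedMul_split_bijective`).

Surjectivity of both maps is reordering by the relations. For injectivity the large algebra is made
to act on the tensor product of the small ones, so that acting on `1 ⊗ₜ 1` inverts the
multiplication map. That the action exists is the real content: `R² = 1` and the Yang–Baxter
equation say exactly that its operators satisfy the defining relations (`modeOp_mul`,
`wickMatrix_mul`, `wickOp_mul`).

Ranks are then multiplicative in the modes, which gives the linear isomorphism. The single-mode
embedding is injective because it is so on each of the two factors of the normally ordered form. -/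

namespace Para

/-! ### Tensors acting on functions of indices, and symmetries of the Yang–Baxter equation. -/

section IndexCalculus

variable {m : ℕ} {M : Type*} [AddCommMonoid M] [Module ℂ M]

/-- The tensor `S` acting on the first two arguments of a function of three indices. -/
def act12 (S : Tensor4 m) (f : Fin m → Fin m → Fin m → M) : Fin m → Fin m → Fin m → M :=
  fun j n l => ∑ r, ∑ s, S (r, s) (j, n) • f r s l

/-- The tensor `S` acting on the last two arguments of a function of three indices. -/
def act23 (S : Tensor4 m) (f : Fin m → Fin m → Fin m → M) : Fin m → Fin m → Fin m → M :=
  fun j n l => ∑ r, ∑ s, S (r, s) (n, l) • f j r s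

/-- A matrix on triples of indices acting from the right on a function of three indices. -/
def actTriple (T : Matrix (Fin m × Fin m × Fin m) (Fin m × Fin m × Fin m) ℂ)
    (f : Fin m → Fin m → Fin m → M) : Fin m → Fin m → Fin m → M :=
  fun j n l => ∑ x, T x (j, n, l) • f x.1 x.2.1 x.2.2

/-- The action is from the right, so products are reversed; this is harmless below because both
Yang–Baxter words are palindromes. -/
theorem actTriple_mul (T U : Matrix (Fin m × Fin m × Fin m) (Fin m × Fin m × Fin m) ℂ)
    (f : Fin m → Fin m → Fin m → M) :
    actTriple (T * U) f = actTriple U (actTriple T f) := by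
  funext j n l
  simp only [actTriple, Matrix.mul_apply, Finset.sum_smul, Finset.smul_sum, smul_smul]
  rw [Finset.sum_comm]
  exact Finset.sum_congr rfl fun x _ => Finset.sum_congr rfl fun y _ => by rw [mul_comm]

theorem actTriple_R12 (S : Tensor4 m) (f : Fin m → Fin m → Fin m → M) :
    actTriple (R12 S) f = act12 S f := by
  funext j n l
  simp [actTriple, R12, act12, Fintype.sum_prod_type]

theorem actTriple_R23 (S : Tensor4 m) (f : Fin m → Fin m → Fin m → M) :
    actTriple (R23 S) f = act23 S f := by
  funext j n l
  simp only [actTriple, R23, act23, Fintype.sum_prod_type]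
  rw [Finset.sum_eq_single j] <;> simp +contextual

theorem IsRMatrix.braid {S : Tensor4 m} (hS : IsRMatrix S) (f : Fin m → Fin m → Fin m → M) :
    act12 S (act23 S (act12 S f)) = act23 S (act12 S (act23 S f)) := by
  simp only [← actTriple_R12, ← actTriple_R23, ← actTriple_mul]
  simp only [hS.yangBaxter]

/-- The opposite transpose of a tensor, governing the annihilation operators. -/
def dual (S : Tensor4 m) : Tensor4 m := fun x y => S (y.2, y.1) (x.2, x.1)

theorem IsRMatrix.transpose {S : Tensor4 m} (hS : IsRMatrix S) : IsRMatrix S.transpose := by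
  have h12 : R12 S.transpose = (R12 S).transpose := by
    ext x y; simp [R12, eq_comm]
  have h23 : R23 S.transpose = (R23 S).transpose := by
    ext x y; simp [R23, eq_comm]
  constructor
  · rw [← Matrix.transpose_mul, hS.involutive, Matrix.transpose_one]
  · rw [h12, h23]
    simp only [← Matrix.transpose_mul, ← mul_assoc, hS.yangBaxter]

/-- Reversal of a triple. -/
def revTriple (m : ℕ) : Fin m × Fin m × Fin m ≃ Fin m × Fin m × Fin m where
  toFun x := (x.2.2, x.2.1, x.1)
  invFun x := (x.2.2, x.2.1, x.1)
  left_inv _ := rfl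
  right_inv _ := rfl

/-- Reversing triples exchanges `R12` and `R23`, hence exchanges the two sides of the Yang–Baxter
equation for the transpose. -/
theorem IsRMatrix.dual {S : Tensor4 m} (hS : IsRMatrix S) : IsRMatrix (dual S) := by
  have hT := hS.transpose
  have h0 : Para.dual S = S.transpose.submatrix (Equiv.prodComm _ _) (Equiv.prodComm _ _) := rfl
  have h12 : R12 (Para.dual S) =
      (R23 S.transpose).submatrix (revTriple m) (revTriple m) := by
    ext x y; simp [R12, R23, Para.dual, revTriple]
  have h23 : R23 (Para.dual S) =
      (R12 S.transpose).submatrix (revTriple m) (revTriple m) := by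
    ext x y; simp [R12, R23, Para.dual, revTriple]
  constructor
  · rw [h0, Matrix.submatrix_mul_equiv, hT.involutive, Matrix.submatrix_one_equiv]
  · rw [h12, h23]
    simp only [Matrix.submatrix_mul_equiv, hT.yangBaxter]

end IndexCalculus

/-! ### Ordered tensor products of algebras with a crossing rule. -/

section CrossOp

variable {A B J : Type*} [Semiring A] [Algebra ℂ A] [Semiring B] [Algebra ℂ B]
  [Fintype J] [DecidableEq J]

/-- The operator on `A ⊗ B` that moves the `j`-th element of the family `q` past `A`, as
prescribed by the matrix representation `h`, and then multiplies it into `B`. -/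
noncomputable def crossOp (h : A →ₐ[ℂ] Matrix J J A) (q : J → B) (j : J) :
    A ⊗[ℂ] B →ₗ[ℂ] A ⊗[ℂ] B :=
  ∑ r, TensorProduct.map (Matrix.entryLinearMap ℂ A j r ∘ₗ h.toLinearMap)
    (LinearMap.mulLeft ℂ (q r))

theorem crossOp_tmul (h : A →ₐ[ℂ] Matrix J J A) (q : J → B) (j : J) (x : A) (y : B) :
    crossOp h q j (x ⊗ₜ y) = ∑ r, h x j r ⊗ₜ (q r * y) := by
  simp [crossOp]

theorem crossOp_one_tmul (h : A →ₐ[ℂ] Matrix J J A) (q : J → B) (j : J) (y : B) :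
    crossOp h q j ((1 : A) ⊗ₜ y) = 1 ⊗ₜ (q j * y) := by
  rw [crossOp_tmul, Finset.sum_eq_single j]
  · simp
  · intro r _ hr
    simp [Matrix.one_apply_ne hr.symm]
  · simp

/-- Multiplicativity of `h` makes the crossing rule hold for left multiplication by any element,
which allows induction over generators of `A`. -/
theorem crossOp_smul (h : A →ₐ[ℂ] Matrix J J A) (q : J → B) (j : J) (p : A) (z : A ⊗[ℂ] B) :
    crossOp h q j (p • z) = ∑ r, h p j r • crossOp h q r z := by
  induction z with
  | zero => simp
  | add z w hz hw => simp [smul_add, hz, hw, Finset.sum_add_distrib]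
  | tmul x y =>
    simp only [TensorProduct.smul_tmul', smul_eq_mul, crossOp_tmul, map_mul, Matrix.mul_apply,
      TensorProduct.sum_tmul, Finset.smul_sum]
    rw [Finset.sum_comm]

/-- The ordered multiplication map of two algebras mapping to a third. -/
noncomputable def orderedMul {X : Type*} [Semiring X] [Algebra ℂ X] (α : A →ₐ[ℂ] X)
    (β : B →ₐ[ℂ] X) : A ⊗[ℂ] B →ₗ[ℂ] X :=
  LinearMap.mul' ℂ X ∘ₗ TensorProduct.map α.toLinearMap β.toLinearMap

theorem orderedMul_tmul {X : Type*} [Semiring X] [Algebra ℂ X] (α : A →ₐ[ℂ] X) (β : B →ₐ[ℂ] X)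
    (x : A) (y : B) : orderedMul α β (x ⊗ₜ y) = α x * β y := by
  simp [orderedMul]

/-- Evaluation at `1 ⊗ₜ 1` is a left inverse: the first factor acts by left multiplication and the
second creates `1 ⊗ₜ y`. -/
theorem orderedMul_injective {X : Type*} [Semiring X] [Algebra ℂ X] (α : A →ₐ[ℂ] X) (β : B →ₐ[ℂ] X)
    (ρ : X →ₐ[ℂ] Module.End ℂ (A ⊗[ℂ] B)) (hα : ∀ x z, ρ (α x) z = x • z)
    (hβ : ∀ y, ρ (β y) (1 ⊗ₜ 1) = 1 ⊗ₜ y) : Function.Injective (orderedMul α β) := by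
  have key : ∀ z, ρ (orderedMul α β z) (1 ⊗ₜ 1) = z := by
    intro z
    induction z with
    | zero => simp
    | add z w hz hw => simp [hz, hw]
    | tmul x y => simp [orderedMul_tmul, hα, hβ, TensorProduct.smul_tmul']
  exact Function.LeftInverse.injective (g := fun t => ρ t (1 ⊗ₜ 1)) key

/-- The range is stable under left multiplication by generators, so it is a left ideal, and it
contains `1`. -/
theorem orderedMul_surjective {X : Type*} [Semiring X] [Algebra ℂ X] (α : A →ₐ[ℂ] X) (β : B →ₐ[ℂ] X)
    (s : Set X) (hs : Algebra.adjoin ℂ s = ⊤)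
    (hmul : ∀ t ∈ s, ∀ x y, t * (α x * β y) ∈ LinearMap.range (orderedMul α β)) :
    Function.Surjective (orderedMul α β) := by
  have key : ∀ t : X, ∀ u ∈ LinearMap.range (orderedMul α β),
      t * u ∈ LinearMap.range (orderedMul α β) := by
    intro t
    have ht : t ∈ Algebra.adjoin ℂ s := hs ▸ Algebra.mem_top
    induction ht using Algebra.adjoin_induction with
    | mem t ht =>
      rintro _ ⟨z, rfl⟩
      induction z with
      | zero => simp
      | add z w hz hw => rw [map_add, mul_add]; exact add_mem hz hw
      | tmul x y => rw [orderedMul_tmul]; exact hmul t ht x y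
    | algebraMap c =>
      intro u hu
      rw [← Algebra.smul_def]
      exact Submodule.smul_mem _ _ hu
    | add t t' _ _ h h' => intro u hu; rw [add_mul]; exact add_mem (h u hu) (h' u hu)
    | mul t t' _ _ h h' => intro u hu; rw [mul_assoc]; exact h _ (h' u hu)
  intro t
  have := key t 1 ⟨1 ⊗ₜ 1, by simp [orderedMul_tmul]⟩
  rwa [mul_one] at this

/-- If the family `q` passes the generators `s` of `A` as prescribed by `h`, it passes all
of `A`. -/
theorem passes_of_generators {X : Type*} [Semiring X] [Algebra ℂ X] (α : A →ₐ[ℂ] X)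
    (h : A →ₐ[ℂ] Matrix J J A) (q : J → X) (s : Set A) (hs : Algebra.adjoin ℂ s = ⊤)
    (hq : ∀ x ∈ s, ∀ j, q j * α x = ∑ r, α (h x j r) * q r) (x : A) (j : J) :
    q j * α x = ∑ r, α (h x j r) * q r := by
  have hx : x ∈ Algebra.adjoin ℂ s := hs ▸ Algebra.mem_top
  induction hx using Algebra.adjoin_induction generalizing j with
  | mem x hx => exact hq x hx j
  | algebraMap c =>
    rw [Finset.sum_eq_single j]
    · simp [Matrix.algebraMap_matrix_apply, Algebra.commutes]
    · intro r _ hr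
      simp [Matrix.algebraMap_matrix_apply, hr.symm]
    · simp
  | add x y _ _ hx hy => simp [mul_add, add_mul, hx, hy, Finset.sum_add_distrib]
  | mul x y _ _ hx hy =>
    rw [map_mul, ← mul_assoc, hx, Finset.sum_mul]
    simp only [mul_assoc, hy, Finset.mul_sum, map_mul, Matrix.mul_apply, map_sum, Finset.sum_mul]
    rw [Finset.sum_comm]

/-- Induction on `A ⊗ B` over left multiplication by generators of `A`. -/
theorem tensor_generator_induction (s : Set A) (hs : Algebra.adjoin ℂ s = ⊤)
    {P : A ⊗[ℂ] B → Prop} (hone : ∀ y, P (1 ⊗ₜ y)) (hadd : ∀ z w, P z → P w → P (z + w))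
    (hsmul : ∀ (c : ℂ) z, P z → P (c • z)) (hgen : ∀ x ∈ s, ∀ z, P z → P (x • z))
    (z : A ⊗[ℂ] B) : P z := by
  have key : ∀ x : A, ∀ z, P z → P (x • z) := by
    intro x
    have hx : x ∈ Algebra.adjoin ℂ s := hs ▸ Algebra.mem_top
    induction hx using Algebra.adjoin_induction with
    | mem x hx => exact hgen x hx
    | algebraMap c => intro z hz; rw [algebraMap_smul]; exact hsmul c z hz
    | add x y _ _ hx hy => intro z hz; rw [add_smul]; exact hadd _ _ (hx z hz) (hy z hz)
    | mul x y _ _ hx hy => intro z hz; rw [mul_smul]; exact hx _ (hy z hz)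
  induction z with
  | zero => simpa using hsmul 0 _ (hone 0)
  | add z w hz hw => exact hadd z w hz hw
  | tmul x y => simpa [TensorProduct.smul_tmul'] using key x _ (hone y)

end CrossOp

/-! ### The quadratic algebra of one type of operators. -/

section ModeAlg

variable {m : ℕ}

/-- The quadratic relations between generators with modes in `α`. -/
inductive ModeRel (S : Tensor4 m) (α : Type) :
    FreeAlgebra ℂ (α × Fin m) → FreeAlgebra ℂ (α × Fin m) → Prop
  | mul (a b : α) (i j : Fin m) :
      ModeRel S α (FreeAlgebra.ι ℂ (a, i) * FreeAlgebra.ι ℂ (b, j))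
        (∑ k : Fin m, ∑ l : Fin m,
          S (k, l) (i, j) • (FreeAlgebra.ι ℂ (b, k) * FreeAlgebra.ι ℂ (a, l)))

/-- The quadratic algebra of creation operators with modes in `α`. -/
abbrev ModeAlg (S : Tensor4 m) (α : Type) : Type := RingQuot (ModeRel S α)

namespace ModeAlg

variable (S : Tensor4 m) {α β : Type}

/-- The generators of the quadratic algebra. -/
noncomputable def gen (a : α) (i : Fin m) : ModeAlg S α :=
  RingQuot.mkAlgHom ℂ (ModeRel S α) (FreeAlgebra.ι ℂ (a, i))

theorem gen_mul_gen (a b : α) (i j : Fin m) :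
    gen S a i * gen S b j = ∑ k, ∑ l, S (k, l) (i, j) • (gen S b k * gen S a l) := by
  have := RingQuot.mkAlgHom_rel ℂ (ModeRel.mul (S := S) a b i j)
  simp only [map_mul, map_sum, map_smul] at this
  exact this

variable {S} {C : Type*} [Semiring C] [Algebra ℂ C]

/-- The universal property of the quadratic algebra. -/
noncomputable def lift (f : α → Fin m → C)
    (hf : ∀ a b i j, f a i * f b j = ∑ k, ∑ l, S (k, l) (i, j) • (f b k * f a l)) :
    ModeAlg S α →ₐ[ℂ] C :=
  RingQuot.liftAlgHom ℂ ⟨FreeAlgebra.lift ℂ fun x => f x.1 x.2, by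
    rintro _ _ ⟨a, b, i, j⟩
    simpa using hf a b i j⟩

theorem lift_gen (f : α → Fin m → C)
    (hf : ∀ a b i j, f a i * f b j = ∑ k, ∑ l, S (k, l) (i, j) • (f b k * f a l))
    (a : α) (i : Fin m) : lift f hf (gen S a i) = f a i := by
  simp [lift, gen]

theorem hom_ext {f g : ModeAlg S α →ₐ[ℂ] C} (h : ∀ a i, f (gen S a i) = g (gen S a i)) :
    f = g := by
  apply RingQuot.ringQuot_ext'
  apply FreeAlgebra.hom_ext
  funext x
  exact h x.1 x.2

variable (S α) in
theorem adjoin_gen :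
    Algebra.adjoin ℂ (Set.range fun x : α × Fin m => gen S x.1 x.2) = ⊤ := by
  have h : (Set.range fun x : α × Fin m => gen S x.1 x.2) =
      RingQuot.mkAlgHom ℂ (ModeRel S α) '' Set.range (FreeAlgebra.ι ℂ) := by
    rw [← Set.range_comp]; rfl
  rw [h, Algebra.adjoin_image, FreeAlgebra.adjoin_range_ι, Algebra.map_top,
    AlgHom.range_eq_top]
  exact RingQuot.mkAlgHom_surjective ℂ _

/-- The homomorphism of quadratic algebras induced by a map of modes. -/
noncomputable def map (f : α → β) : ModeAlg S α →ₐ[ℂ] ModeAlg S β :=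
  lift (fun a i => gen S (f a) i) fun a b => gen_mul_gen S (f a) (f b)

@[simp]
theorem map_gen (f : α → β) (a : α) (i : Fin m) : map f (gen S a i) = gen S (f a) i :=
  lift_gen _ _ a i

theorem map_leftInverse {f : α → β} {g : β → α} (h : Function.LeftInverse g f) :
    Function.LeftInverse (map (S := S) g) (map f) := by
  have : (map (S := S) g).comp (map f) = AlgHom.id ℂ _ := hom_ext fun a i => by simp [h a]
  exact fun x => DFunLike.congr_fun this x

/-- Reindexing of modes. -/
noncomputable def congr (e : α ≃ β) : ModeAlg S α ≃ₗ[ℂ] ModeAlg S β :=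
  { (map e).toLinearMap with
    invFun := map e.symm
    left_inv := map_leftInverse e.left_inv
    right_inv := map_leftInverse e.right_inv }

theorem rank_of_isEmpty [IsEmpty α] : Module.rank ℂ (ModeAlg S α) = 1 := by
  let ε : ModeAlg S α →ₐ[ℂ] ℂ := lift (fun a => isEmptyElim a) fun a => isEmptyElim a
  have hsurj : Function.Surjective (algebraMap ℂ (ModeAlg S α)) := by
    intro x
    have hx : x ∈ Algebra.adjoin ℂ (Set.range fun x : α × Fin m => gen S x.1 x.2) :=
      adjoin_gen S α ▸ Algebra.mem_top
    rw [Set.range_eq_empty, Algebra.adjoin_empty, Algebra.mem_bot] at hx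
    exact hx
  have hinj : Function.Injective (algebraMap ℂ (ModeAlg S α)) :=
    Function.LeftInverse.injective (g := ε) fun c => by simp
  let e : ℂ ≃ₗ[ℂ] ModeAlg S α :=
    LinearEquiv.ofBijective (Algebra.linearMap ℂ (ModeAlg S α)) ⟨hinj, hsurj⟩
  rw [← e.rank_eq, Module.rank_self]

end ModeAlg

end ModeAlg

/-! ### Factorization of the quadratic algebra over a disjoint union of modes. -/

section SplitModes

variable {m : ℕ} {S : Tensor4 m}

namespace ModeAlg

variable {α β : Type}

/-- The indicator `l' = l` turns the fixed index into a third argument, so that the matrix product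
becomes a word in `act12` and `act23` to which `IsRMatrix.braid` applies. -/
theorem modeMatrix_mul (S : Tensor4 m) (a c : α) (n r j l : Fin m) :
    ∑ t, (∑ k, S (k, t) (j, n) • gen S a k) * (∑ k, S (k, l) (t, r) • gen S c k) =
      act12 S (act23 S fun k k' l' => if l' = l then gen S a k * gen S c k' else 0) j n r := by
  simp only [act12, act23, smul_ite, smul_zero, Finset.sum_ite_eq',
    Finset.mem_univ, if_true, Finset.sum_mul, Finset.mul_sum, Finset.smul_sum,
    smul_mul_smul_comm, smul_smul]
  exact (Finset.sum_congr rfl fun t _ => Finset.sum_comm).trans Finset.sum_comm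

/-- The representation recording how a generator of a further mode passes the algebra. -/
noncomputable def modeRep (hS : IsRMatrix S) (α : Type) :
    ModeAlg S α →ₐ[ℂ] Matrix (Fin m) (Fin m) (ModeAlg S α) :=
  lift (fun a n => Matrix.of fun j l => ∑ k, S (k, l) (j, n) • gen S a k) <| by
    intro a c n r
    ext j l
    simp only [Matrix.mul_apply, Matrix.sum_apply, Matrix.smul_apply, Matrix.of_apply,
      modeMatrix_mul]
    -- The swapped product carries an additional outer `act23`. The braid relation trades it for an
    -- innermost `act12`, which is the exchange relation of the generators.
    change _ = act23 S (act12 S (act23 S fun k k' l' =>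
      if l' = l then gen S c k * gen S a k' else 0)) j n r
    rw [← hS.braid]
    congr 2
    funext k k' l'
    by_cases h : l' = l
    · simp [act12, h, gen_mul_gen S a c]
    · simp [act12, h]

theorem modeRep_gen (hS : IsRMatrix S) (a : α) (n j l : Fin m) :
    modeRep hS α (gen S a n) j l = ∑ k, S (k, l) (j, n) • gen S a k := by
  simp [modeRep, lift_gen]

/-- The operator of a further mode on the ordered tensor product of two quadratic algebras. -/
noncomputable def modeOp (hS : IsRMatrix S) (α : Type) {β : Type} (b : β) (j : Fin m) :
    Module.End ℂ (ModeAlg S α ⊗[ℂ] ModeAlg S β) :=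
  crossOp (modeRep hS α) (gen S b) j

theorem modeOp_gen_smul (hS : IsRMatrix S) (a : α) (b : β) (j n : Fin m)
    (z : ModeAlg S α ⊗[ℂ] ModeAlg S β) :
    modeOp hS α b j (gen S a n • z) =
      ∑ k, ∑ l, S (k, l) (j, n) • gen S a k • modeOp hS α b l z := by
  rw [modeOp, crossOp_smul, Finset.sum_comm]
  simp only [modeRep_gen, Finset.sum_smul, smul_assoc, modeOp]

theorem modeOp_modeOp_gen_smul (hS : IsRMatrix S) (a : α) (b c : β) (j i n : Fin m)
    (z : ModeAlg S α ⊗[ℂ] ModeAlg S β) :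
    modeOp hS α b j (modeOp hS α c i (gen S a n • z)) =
      act23 S (act12 S fun k t l => gen S a k • modeOp hS α b t (modeOp hS α c l z)) j i n := by
  rw [modeOp_gen_smul]
  simp only [map_sum, map_smul, modeOp_gen_smul]
  rfl

/-- On `1 ⊗ₜ y` this is the relation of the second algebra; the braid relation carries it past each
generator of the first. All indices must be quantified in the induction, since a crossing mixes
them. -/
theorem modeOp_mul (hS : IsRMatrix S) (b c : β) (j i : Fin m) :
    modeOp hS α b j * modeOp hS α c i =
      ∑ k, ∑ l, S (k, l) (j, i) • (modeOp hS α c k * modeOp hS α b l) := by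
  suffices h : ∀ z j i, modeOp hS α b j (modeOp hS α c i z) =
      ∑ k, ∑ l, S (k, l) (j, i) • modeOp hS α c k (modeOp hS α b l z) from
    LinearMap.ext fun z => by
      simpa only [Module.End.mul_apply, LinearMap.sum_apply, LinearMap.smul_apply] using h z j i
  intro z
  refine tensor_generator_induction _ (adjoin_gen S α) (P := fun z => ∀ j i,
      modeOp hS α b j (modeOp hS α c i z) =
        ∑ k, ∑ l, S (k, l) (j, i) • modeOp hS α c k (modeOp hS α b l z))
    (fun y j i => ?_) (fun z w hz hw j i => ?_) (fun t z hz j i => ?_) ?_ z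
  · simp only [modeOp, crossOp_one_tmul, ← mul_assoc, gen_mul_gen S b c j i, Finset.sum_mul,
      TensorProduct.tmul_sum, smul_mul_assoc, TensorProduct.tmul_smul]
  · simp only [map_add, hz, hw, smul_add, Finset.sum_add_distrib]
  · simp only [map_smul, hz, Finset.smul_sum, smul_comm t]
  · rintro _ ⟨⟨a, n⟩, rfl⟩ z hz j i
    simp only [modeOp_modeOp_gen_smul]
    change _ = act12 S (act23 S (act12 S _)) j i n
    rw [hS.braid]
    congr 2
    funext k t l
    simp only [act23, hz t l, Finset.smul_sum, smul_comm (gen S a k)]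

/-- The involutivity of a tensor, applied to a function of two indices. -/
theorem _root_.Para.IsRMatrix.sum_sum {M : Type*} [AddCommMonoid M] [Module ℂ M]
    (hS : IsRMatrix S) (f : Fin m → Fin m → M) (i j : Fin m) :
    ∑ k, ∑ l, S (k, l) (i, j) • ∑ r, ∑ s, S (r, s) (k, l) • f r s = f i j := by
  have h : ∀ r s, ∑ k, ∑ l, S (r, s) (k, l) * S (k, l) (i, j) =
      if (r, s) = (i, j) then 1 else 0 := by
    intro r s
    rw [← Matrix.one_apply, ← hS.involutive, Matrix.mul_apply, Fintype.sum_prod_type]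
  have h' : ∑ x : Fin m × Fin m, ∑ y : Fin m × Fin m, (S y x * S x (i, j)) • f y.1 y.2 =
      f i j := by
    rw [Finset.sum_comm]
    simp only [← Finset.sum_smul, Fintype.sum_prod_type, h]
    simp [Prod.ext_iff, ite_and]
  rw [← h']
  simp only [Fintype.sum_prod_type, Finset.smul_sum, smul_smul, mul_comm]

/-- The action of the quadratic algebra on a disjoint union of modes on ordered tensors. -/
noncomputable def splitAction (hS : IsRMatrix S) (α β : Type) :
    ModeAlg S (α ⊕ β) →ₐ[ℂ] Module.End ℂ (ModeAlg S α ⊗[ℂ] ModeAlg S β) :=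
  lift (C := Module.End ℂ (ModeAlg S α ⊗[ℂ] ModeAlg S β))
    (Sum.elim (fun a i => Algebra.lsmul ℂ ℂ _ (gen S a i)) (modeOp hS α)) <| by
    have hcross : ∀ (a : α) (b : β) i j, modeOp hS α b i * Algebra.lsmul ℂ ℂ _ (gen S a j) =
        ∑ k, ∑ l, S (k, l) (i, j) •
          ((Algebra.lsmul ℂ ℂ _ (gen S a k) : Module.End ℂ _) * modeOp hS α b l) := by
      intro a b i j
      refine LinearMap.ext fun z => ?_
      simp [modeOp_gen_smul]
    rintro (a | a) (b | b) i j
    · simp only [Sum.elim_inl, ← map_mul, gen_mul_gen S a b, map_sum, map_smul]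
    -- The opposite order is the inverse of `hcross`, and `S² = 1` makes this inverse have the same
    -- form.
    · simp only [Sum.elim_inl, Sum.elim_inr, hcross, hS.sum_sum]
    · exact hcross b a i j
    · exact modeOp_mul hS a b i j

theorem orderedMul_split_bijective (hS : IsRMatrix S) (α β : Type) :
    Function.Bijective
      (orderedMul (map (S := S) (Sum.inl : α → α ⊕ β)) (map (Sum.inr : β → α ⊕ β))) := by
  constructor
  · apply orderedMul_injective _ _ (splitAction hS α β)
    · have : (splitAction hS α β).comp (map Sum.inl) = Algebra.lsmul ℂ ℂ _ :=
        hom_ext fun a i => by simp [splitAction, lift_gen]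
      intro x z
      exact DFunLike.congr_fun (DFunLike.congr_fun this x) z
    -- Crossing `1` is trivial, so the second algebra only multiplies the second factor.
    · have key : ∀ x y : ModeAlg S β,
          splitAction hS α β (map Sum.inr x) (1 ⊗ₜ y) = 1 ⊗ₜ (x * y) := by
        intro x
        have hx : x ∈ Algebra.adjoin ℂ (Set.range fun x : β × Fin m => gen S x.1 x.2) :=
          adjoin_gen S β ▸ Algebra.mem_top
        induction hx using Algebra.adjoin_induction with
        | mem x hx =>
          obtain ⟨⟨b, j⟩, rfl⟩ := hx
          intro y
          simp [splitAction, lift_gen, modeOp, crossOp_one_tmul]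
        | algebraMap c =>
          intro y
          simp [Module.algebraMap_end_apply, ← Algebra.smul_def]
        | add x x' _ _ hx hx' => intro y; simp [hx, hx', add_mul, TensorProduct.tmul_add]
        | mul x x' _ _ hx hx' => intro y; simp [hx, hx', mul_assoc]
      intro y
      rw [key, mul_one]
  · apply orderedMul_surjective _ _ _ (adjoin_gen S (α ⊕ β))
    rintro _ ⟨⟨a | b, i⟩, rfl⟩ x y
    · exact ⟨(gen S a i * x) ⊗ₜ y, by simp [orderedMul_tmul, mul_assoc]⟩
    · have := passes_of_generators (map (Sum.inl : α → α ⊕ β)) (modeRep hS α)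
        (gen S (Sum.inr b)) _ (adjoin_gen S α) (by
          rintro _ ⟨⟨a, n⟩, rfl⟩ j
          simp only [map_gen, gen_mul_gen S (Sum.inr b), modeRep_gen, map_sum, map_smul,
            Finset.sum_mul, smul_mul_assoc]
          rw [Finset.sum_comm]) x i
      refine ⟨∑ r, modeRep hS α x i r ⊗ₜ (gen S b r * y), ?_⟩
      simp only [map_sum, orderedMul_tmul, map_mul, map_gen, ← mul_assoc, this, Finset.sum_mul]

theorem rank_sum (hS : IsRMatrix S) (α β : Type) : Module.rank ℂ (ModeAlg S (α ⊕ β)) =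
    Module.rank ℂ (ModeAlg S α) * Module.rank ℂ (ModeAlg S β) := by
  rw [← (LinearEquiv.ofBijective _ (orderedMul_split_bijective hS α β)).rank_eq,
    rank_tensorProduct']

theorem rank_fin (hS : IsRMatrix S) (N : ℕ) :
    Module.rank ℂ (ModeAlg S (Fin N)) = Module.rank ℂ (ModeAlg S (Fin 1)) ^ N := by
  induction N with
  | zero => rw [rank_of_isEmpty, pow_zero]
  | succ N ih => rw [← (congr finSumFinEquiv).rank_eq, rank_sum hS, ih, pow_succ]

end ModeAlg
end SplitModes

/-! ### Annihilation operators passing creation operators, with contractions. -/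

section NormalOrdering

variable {m : ℕ} {R : Tensor4 m} {γ : Type}

open ModeAlg

theorem wickMatrix_sum (R : Tensor4 m) (b c : γ) (n r i l : Fin m) :
    ∑ t, (∑ k, R (i, k) (n, t) • gen R b k) * (∑ k, R (t, k) (r, l) • gen R c k) =
      act23 R (act12 R fun i' k k' => if i' = i then gen R b k * gen R c k' else 0) n r l := by
  have h : ∀ t k', act12 R (fun i' k k' => if i' = i then gen R b k * gen R c k' else 0) n t k' =
      ∑ k, R (i, k) (n, t) • (gen R b k * gen R c k') := by
    intro t k'
    rw [act12, Finset.sum_eq_single i] <;> simp +contextual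
  simp only [act23, h, Finset.sum_mul, Finset.mul_sum, Finset.smul_sum, smul_mul_smul_comm,
    smul_smul]
  refine Finset.sum_congr rfl fun t _ => ?_
  simp only [mul_comm]

variable [DecidableEq γ]

/-- The matrix recording how the annihilation operators of mode `a` pass a creation operator,
with the contraction in the column `none`. -/
noncomputable def wickMatrix (R : Tensor4 m) (a b : γ) (n : Fin m) :
    Matrix (Option (Fin m)) (Option (Fin m)) (ModeAlg R γ) :=
  Matrix.of fun o o' => match o, o' with
    | some i, some l => ∑ k, R (i, k) (n, l) • gen R b k
    | some i, none => if a = b ∧ i = n then 1 else 0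
    | none, some _ => 0
    | none, none => gen R b n

theorem wickMatrix_some_some (a b : γ) (n i l : Fin m) :
    wickMatrix R a b n (some i) (some l) = ∑ k, R (i, k) (n, l) • gen R b k := rfl

theorem wickMatrix_some_none (a b : γ) (n i : Fin m) :
    wickMatrix R a b n (some i) none = if a = b ∧ i = n then 1 else 0 := rfl

theorem wickMatrix_none_some (a b : γ) (n l : Fin m) :
    wickMatrix R a b n none (some l) = 0 := rfl

theorem wickMatrix_none_none (a b : γ) (n : Fin m) :
    wickMatrix R a b n none none = gen R b n := rfl

/-- Crossing is compatible with the creation relations: the block without contraction is the braid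
relation, and the contraction column uses `R² = 1`. -/
theorem wickMatrix_mul (hR : IsRMatrix R) (a b c : γ) (n r : Fin m) :
    wickMatrix R a b n * wickMatrix R a c r =
      ∑ k, ∑ l, R (k, l) (n, r) • (wickMatrix R a c k * wickMatrix R a b l) := by
  ext o o'
  simp only [Matrix.mul_apply, Matrix.sum_apply, Matrix.smul_apply, Fintype.sum_option]
  rcases o with _ | i <;> rcases o' with _ | l
  · simp [wickMatrix_none_some, wickMatrix_none_none, gen_mul_gen R b c]
  · simp [wickMatrix_none_some, wickMatrix_none_none]
  · have h := hR.sum_sum (fun s t => if a = b ∧ i = s then gen R c t else 0) n r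
    simp only [wickMatrix_some_none, wickMatrix_none_none, wickMatrix_some_some, smul_add,
      Finset.sum_add_distrib]
    -- Contraction with mode `c` matches directly; contraction with mode `b` produces `R²` on the
    -- right and needs `h`.
    rw [add_comm]
    congr 1
    · by_cases hac : a = c
      · subst hac
        simp only [true_and, mul_ite, mul_one, mul_zero, Finset.sum_ite_eq', Finset.mem_univ,
          if_true, ite_mul, one_mul, zero_mul, smul_ite, smul_zero]
        symm
        rw [Finset.sum_eq_single i] <;> simp +contextual [eq_comm]
      · simp [hac]
    · simp only [ite_mul, one_mul, zero_mul]
      rw [← h]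
      by_cases hab : a = b
      · subst hab
        simp
      · simp [hab]
  · simp only [wickMatrix_some_none, wickMatrix_none_some, wickMatrix_some_some, mul_zero, zero_add,
      wickMatrix_sum]
    change _ = act12 R (act23 R (act12 R fun i' k k' =>
      if i' = i then gen R c k * gen R b k' else 0)) n r l
    rw [hR.braid]
    congr 2
    funext i' k k'
    by_cases h : i' = i
    · simp [act23, h, gen_mul_gen R b c]
    · simp [act23, h]

/-- The representation recording how annihilation operators of mode `a` pass the algebra of
creation operators. -/
noncomputable def wickRep (hR : IsRMatrix R) (a : γ) :
    ModeAlg R γ →ₐ[ℂ] Matrix (Option (Fin m)) (Option (Fin m)) (ModeAlg R γ) :=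
  lift (wickMatrix R a) (wickMatrix_mul hR a)

theorem wickRep_gen (hR : IsRMatrix R) (a b : γ) (n : Fin m) :
    wickRep hR a (gen R b n) = wickMatrix R a b n :=
  lift_gen _ _ b n

/-- A family extended by the value `1` at `none`. -/
noncomputable def withOne {C : Type*} [One C] (q : Fin m → C) : Option (Fin m) → C :=
  fun o => o.elim 1 q

/-- The annihilation operators, and the identity, on the module of ordered tensors. -/
noncomputable def wickOp (hR : IsRMatrix R) (a : γ) (o : Option (Fin m)) :
    Module.End ℂ (ModeAlg R γ ⊗[ℂ] ModeAlg (dual R) γ) :=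
  crossOp (wickRep hR a) (withOne (gen (dual R) a)) o

theorem wickOp_smul (hR : IsRMatrix R) (a b : γ) (n : Fin m) (o : Option (Fin m))
    (z : ModeAlg R γ ⊗[ℂ] ModeAlg (dual R) γ) :
    wickOp hR a o (gen R b n • z) = wickMatrix R a b n o none • wickOp hR a none z +
      ∑ l, wickMatrix R a b n o (some l) • wickOp hR a (some l) z := by
  rw [wickOp, crossOp_smul, Fintype.sum_option, wickRep_gen]
  rfl

theorem wickOp_one_tmul (hR : IsRMatrix R) (a : γ) (i : Fin m) (y : ModeAlg (dual R) γ) :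
    wickOp hR a (some i) (1 ⊗ₜ y) = 1 ⊗ₜ (gen (dual R) a i * y) :=
  crossOp_one_tmul _ _ _ _

/-- Row `none` of `wickMatrix` vanishes off the diagonal, so this operator commutes with the
creation algebra, and it fixes `1 ⊗ₜ y`. -/
theorem wickOp_none (hR : IsRMatrix R) (a : γ) : wickOp hR a none = 1 := by
  refine LinearMap.ext fun z => ?_
  refine tensor_generator_induction _ (adjoin_gen R γ) (P := fun z => wickOp hR a none z = z)
    (fun y => ?_) (fun z w hz hw => ?_) (fun t z hz => ?_) ?_ z
  · simp [wickOp, crossOp_one_tmul, withOne]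
  · rw [map_add, hz, hw]
  · rw [map_smul, hz]
  · rintro _ ⟨⟨b, n⟩, rfl⟩ z hz
    simp [wickOp_smul, wickMatrix_none_none, wickMatrix_none_some, hz]

theorem wickOp_some_smul (hR : IsRMatrix R) (a b : γ) (n i : Fin m)
    (z : ModeAlg R γ ⊗[ℂ] ModeAlg (dual R) γ) :
    wickOp hR a (some i) (gen R b n • z) =
      ∑ k, ∑ l, R (i, k) (n, l) • gen R b k • wickOp hR a (some l) z +
        if a = b ∧ i = n then z else 0 := by
  rw [wickOp_smul, wickOp_none, add_comm, Finset.sum_comm]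
  simp only [wickMatrix_some_none, wickMatrix_some_some, Finset.sum_smul, smul_assoc,
    Module.End.one_apply, ite_smul, one_smul, zero_smul]

/-- Moving two annihilators past one creator leaves a fully crossed term and one term for each
possible contraction. The annihilator indices are summed as lower indices of `R`, hence the
transpose. -/
theorem wickOp_wickOp_smul (hR : IsRMatrix R) (a b c : γ) (i j n : Fin m)
    (z : ModeAlg R γ ⊗[ℂ] ModeAlg (dual R) γ) :
    wickOp hR a (some i) (wickOp hR b (some j) (gen R c n • z)) =
      ∑ s, gen R c s • act23 R.transpose (act12 R.transpose fun r l t =>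
        if r = n then wickOp hR a (some t) (wickOp hR b (some l) z) else 0) j i s +
      (if a = c then ∑ l, R (j, i) (n, l) • wickOp hR b (some l) z else 0) +
      if b = c ∧ j = n then wickOp hR a (some i) z else 0 := by
  have h : ∀ k t, act12 R.transpose (fun r l t =>
      if r = n then wickOp hR a (some t) (wickOp hR b (some l) z) else 0) j k t =
      ∑ l, R (j, k) (n, l) • wickOp hR a (some t) (wickOp hR b (some l) z) := by
    intro k t
    rw [act12, Finset.sum_eq_single n] <;> simp +contextual
  rw [wickOp_some_smul]
  simp only [map_add, map_sum, map_smul, wickOp_some_smul, smul_add, Finset.sum_add_distrib]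
  congr 1
  · congr 1
    · simp only [act23, h, Finset.smul_sum, Matrix.transpose_apply, smul_comm (gen R c _)]
      refine Eq.trans (Finset.sum_congr rfl fun k _ => ?_) Finset.sum_comm
      rw [Finset.sum_comm]
      refine Finset.sum_congr rfl fun s _ => ?_
      rw [Finset.sum_comm]
      exact Finset.sum_congr rfl fun t _ => Finset.sum_congr rfl fun l _ => smul_comm _ _ _
    · by_cases hac : a = c
      · rw [Finset.sum_eq_single i] <;> simp +contextual [hac, eq_comm]
      · simp [hac]
  · split_ifs <;> simp

theorem wickOp_mul (hR : IsRMatrix R) (a b : γ) (i j : Fin m) :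
    wickOp hR a (some i) * wickOp hR b (some j) =
      ∑ k, ∑ l, dual R (k, l) (i, j) • (wickOp hR b (some k) * wickOp hR a (some l)) := by
  suffices h : ∀ z i j, wickOp hR a (some i) (wickOp hR b (some j) z) =
      ∑ k, ∑ l, dual R (k, l) (i, j) • wickOp hR b (some k) (wickOp hR a (some l) z) from
    LinearMap.ext fun z => by
      simpa only [Module.End.mul_apply, LinearMap.sum_apply, LinearMap.smul_apply] using h z i j
  intro z
  refine tensor_generator_induction _ (adjoin_gen R γ) (P := fun z => ∀ i j,
      wickOp hR a (some i) (wickOp hR b (some j) z) =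
        ∑ k, ∑ l, dual R (k, l) (i, j) • wickOp hR b (some k) (wickOp hR a (some l) z))
    (fun y i j => ?_) (fun z w hz hw i j => ?_) (fun t z hz i j => ?_) ?_ z
  · simp only [wickOp_one_tmul, ← mul_assoc, gen_mul_gen (dual R) a b i j, Finset.sum_mul,
      TensorProduct.tmul_sum, smul_mul_assoc, TensorProduct.tmul_smul]
  · simp only [map_add, hz, hw, smul_add, Finset.sum_add_distrib]
  · simp only [map_smul, hz, Finset.smul_sum, smul_comm t]
  · rintro _ ⟨⟨c, n⟩, rfl⟩ z hz i j
    have hT := hR.transpose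
    -- The induction hypothesis, read as an exchange in the last two indices.
    have hQ : act23 R.transpose (fun r l t =>
        if r = n then wickOp hR b (some t) (wickOp hR a (some l) z) else 0) = fun r l t =>
        if r = n then wickOp hR a (some t) (wickOp hR b (some l) z) else 0 := by
      funext r l t
      by_cases hr : r = n
      · simp only [act23, hr, if_true, hz t l, dual, Matrix.transpose_apply]
        exact Finset.sum_comm
      · simp [act23, hr]
    -- Of the two contraction terms, the one with `b = c` needs involutivity; the one with `a = c`
    -- matches by the definition of `dual`.
    have hlin := hT.sum_sum (fun r s => if b = c ∧ r = n then wickOp hR a (some s) z else 0) j i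
    simp only [wickOp_wickOp_smul, smul_add, Finset.sum_add_distrib]
    rw [add_assoc, add_assoc]
    congr 1
    · rw [← hQ, ← hT.braid]
      generalize act23 R.transpose (act12 R.transpose (M := ModeAlg R γ ⊗[ℂ] ModeAlg (dual R) γ)
        _) = F
      simp only [act12, Finset.smul_sum, smul_comm (gen R c _), dual, Matrix.transpose_apply]
      rw [Finset.sum_comm]
      refine Eq.trans (Finset.sum_congr rfl fun l _ => Finset.sum_comm) ?_
      exact Finset.sum_comm
    · rw [add_comm]
      congr 1
      · rw [← hlin, Finset.sum_comm]
        refine Finset.sum_congr rfl fun k _ => Finset.sum_congr rfl fun l _ => ?_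
        congr 1
        by_cases hbc : b = c
        · rw [Finset.sum_eq_single n] <;> simp +contextual [hbc]
        · simp [hbc]
      · by_cases hac : a = c
        · simp [hac, dual]
        · simp [hac]

end NormalOrdering

/-! ### Normal ordering in the full algebra, and both claims. -/

section Fock

variable {m : ℕ} {R : Tensor4 m} {N : ℕ}

open ModeAlg

theorem create_mul_create (R : Tensor4 m) (a b : Fin N) (i j : Fin m) :
    create R a i * create R b j =
      ∑ k, ∑ l, R (k, l) (i, j) • (create R b k * create R a l) := by
  have := RingQuot.mkAlgHom_rel ℂ (CommRel.create_create (R := R) a b i j)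
  simp only [map_mul, map_sum, map_smul] at this
  exact this

theorem annihilate_mul_annihilate (R : Tensor4 m) (a b : Fin N) (i j : Fin m) :
    annihilate R a i * annihilate R b j =
      ∑ k, ∑ l, dual R (k, l) (i, j) • (annihilate R b k * annihilate R a l) := by
  have := RingQuot.mkAlgHom_rel ℂ (CommRel.annihilate_annihilate (R := R) a b i j)
  simp only [map_mul, map_sum, map_smul] at this
  exact this

theorem annihilate_mul_create (R : Tensor4 m) (a b : Fin N) (i j : Fin m) :
    annihilate R a i * create R b j =
      ∑ k, ∑ l, R (i, k) (j, l) • (create R b k * annihilate R a l) +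
        if a = b ∧ i = j then 1 else 0 := by
  have := RingQuot.mkAlgHom_rel ℂ (CommRel.annihilate_create (R := R) a b i j)
  simp only [map_mul, map_sum, map_smul, map_add, apply_ite (RingQuot.mkAlgHom ℂ (CommRel R N)),
    map_one, map_zero] at this
  exact this

/-- The universal property of the algebra of creation and annihilation operators. -/
noncomputable def XN.lift {C : Type*} [Semiring C] [Algebra ℂ C] (p q : Fin N → Fin m → C)
    (hqp : ∀ a b i j, q a i * p b j =
      ∑ k, ∑ l, R (i, k) (j, l) • (p b k * q a l) + if a = b ∧ i = j then 1 else 0)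
    (hpp : ∀ a b i j, p a i * p b j = ∑ k, ∑ l, R (k, l) (i, j) • (p b k * p a l))
    (hqq : ∀ a b i j, q a i * q b j = ∑ k, ∑ l, dual R (k, l) (i, j) • (q b k * q a l)) :
    XN R N →ₐ[ℂ] C :=
  RingQuot.liftAlgHom ℂ ⟨FreeAlgebra.lift ℂ fun g => Gen.casesOn g p q, by
    rintro _ _ (⟨a, b, i, j⟩ | ⟨a, b, i, j⟩ | ⟨a, b, i, j⟩)
    · simpa [fa, fc, apply_ite] using hqp a b i j
    · simpa [fc] using hpp a b i j
    · simpa [fa, dual] using hqq a b i j⟩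

theorem XN.lift_create {C : Type*} [Semiring C] [Algebra ℂ C] (p q : Fin N → Fin m → C)
    (hqp : ∀ a b i j, q a i * p b j =
      ∑ k, ∑ l, R (i, k) (j, l) • (p b k * q a l) + if a = b ∧ i = j then 1 else 0)
    (hpp : ∀ a b i j, p a i * p b j = ∑ k, ∑ l, R (k, l) (i, j) • (p b k * p a l))
    (hqq : ∀ a b i j, q a i * q b j = ∑ k, ∑ l, dual R (k, l) (i, j) • (q b k * q a l))
    (a : Fin N) (i : Fin m) : XN.lift p q hqp hpp hqq (create R a i) = p a i := by
  simp [XN.lift, create, fc]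

theorem XN.lift_annihilate {C : Type*} [Semiring C] [Algebra ℂ C] (p q : Fin N → Fin m → C)
    (hqp : ∀ a b i j, q a i * p b j =
      ∑ k, ∑ l, R (i, k) (j, l) • (p b k * q a l) + if a = b ∧ i = j then 1 else 0)
    (hpp : ∀ a b i j, p a i * p b j = ∑ k, ∑ l, R (k, l) (i, j) • (p b k * p a l))
    (hqq : ∀ a b i j, q a i * q b j = ∑ k, ∑ l, dual R (k, l) (i, j) • (q b k * q a l))
    (a : Fin N) (i : Fin m) : XN.lift p q hqp hpp hqq (annihilate R a i) = q a i := by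
  simp [XN.lift, annihilate, fa]

theorem XN.adjoin_eq_top (R : Tensor4 m) (N : ℕ) :
    Algebra.adjoin ℂ ((Set.range fun x : Fin N × Fin m => create R x.1 x.2) ∪
      Set.range fun x : Fin N × Fin m => annihilate R x.1 x.2) = ⊤ := by
  have h : ((Set.range fun x : Fin N × Fin m => create R x.1 x.2) ∪
      Set.range fun x : Fin N × Fin m => annihilate R x.1 x.2) =
      RingQuot.mkAlgHom ℂ (CommRel R N) '' Set.range (FreeAlgebra.ι ℂ) := by
    rw [← Set.range_comp]
    ext x
    constructor
    · rintro (⟨⟨a, i⟩, rfl⟩ | ⟨⟨a, i⟩, rfl⟩)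
      exacts [⟨Gen.create a i, rfl⟩, ⟨Gen.annihilate a i, rfl⟩]
    · rintro ⟨a | a, rfl⟩
      exacts [Or.inl ⟨(_, _), rfl⟩, Or.inr ⟨(_, _), rfl⟩]
  rw [h, Algebra.adjoin_image, FreeAlgebra.adjoin_range_ι, Algebra.map_top,
    AlgHom.range_eq_top]
  exact RingQuot.mkAlgHom_surjective ℂ _

/-- The algebra of creation operators inside the algebra of all operators. -/
noncomputable def createHom (R : Tensor4 m) (N : ℕ) : ModeAlg R (Fin N) →ₐ[ℂ] XN R N :=
  ModeAlg.lift (create R) (create_mul_create R)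

/-- The algebra of annihilation operators inside the algebra of all operators. -/
noncomputable def annihilateHom (R : Tensor4 m) (N : ℕ) :
    ModeAlg (dual R) (Fin N) →ₐ[ℂ] XN R N :=
  ModeAlg.lift (annihilate R) (annihilate_mul_annihilate R)

@[simp]
theorem createHom_gen (a : Fin N) (i : Fin m) : createHom R N (gen R a i) = create R a i :=
  lift_gen _ _ a i

@[simp]
theorem annihilateHom_gen (a : Fin N) (i : Fin m) :
    annihilateHom R N (gen (dual R) a i) = annihilate R a i :=
  lift_gen _ _ a i

/-- The action of all operators on normally ordered tensors. -/
noncomputable def normalAction (hR : IsRMatrix R) (N : ℕ) :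
    XN R N →ₐ[ℂ] Module.End ℂ (ModeAlg R (Fin N) ⊗[ℂ] ModeAlg (dual R) (Fin N)) :=
  XN.lift (C := Module.End ℂ (ModeAlg R (Fin N) ⊗[ℂ] ModeAlg (dual R) (Fin N)))
    (fun a i => Algebra.lsmul ℂ ℂ _ (gen R a i)) (fun a i => wickOp hR a (some i))
    (fun a b i j => LinearMap.ext fun z => by
      by_cases h : a = b ∧ i = j <;> simp [wickOp_some_smul, h])
    (fun a b i j => by simp only [← map_mul, gen_mul_gen R a b, map_sum, map_smul])
    (wickOp_mul hR)

theorem normalAction_create (hR : IsRMatrix R) (a : Fin N) (i : Fin m) :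
    normalAction hR N (create R a i) = Algebra.lsmul ℂ ℂ _ (gen R a i) :=
  XN.lift_create _ _ _ _ _ a i

theorem normalAction_annihilate (hR : IsRMatrix R) (a : Fin N) (i : Fin m) :
    normalAction hR N (annihilate R a i) = wickOp hR a (some i) :=
  XN.lift_annihilate _ _ _ _ _ a i

/-- Normal ordering: the algebra of all operators is the ordered tensor product of the algebras
of creation and of annihilation operators. -/
theorem normalOrder_bijective (hR : IsRMatrix R) (N : ℕ) :
    Function.Bijective (orderedMul (createHom R N) (annihilateHom R N)) := by
  constructor
  · apply orderedMul_injective _ _ (normalAction hR N)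
    · have : (normalAction hR N).comp (createHom R N) = Algebra.lsmul ℂ ℂ _ :=
        hom_ext fun a i => by simp [normalAction_create]
      intro x z
      exact DFunLike.congr_fun (DFunLike.congr_fun this x) z
    · have key : ∀ x y : ModeAlg (dual R) (Fin N),
          normalAction hR N (annihilateHom R N x) (1 ⊗ₜ y) = 1 ⊗ₜ (x * y) := by
        intro x
        have hx : x ∈ Algebra.adjoin ℂ
            (Set.range fun x : Fin N × Fin m => gen (dual R) x.1 x.2) :=
          adjoin_gen (dual R) (Fin N) ▸ Algebra.mem_top
        induction hx using Algebra.adjoin_induction with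
        | mem x hx =>
          obtain ⟨⟨b, j⟩, rfl⟩ := hx
          intro y
          simp [normalAction_annihilate, wickOp_one_tmul]
        | algebraMap c =>
          intro y
          simp [Module.algebraMap_end_apply, ← Algebra.smul_def]
        | add x x' _ _ hx hx' => intro y; simp [hx, hx', add_mul, TensorProduct.tmul_add]
        | mul x x' _ _ hx hx' => intro y; simp [hx, hx', mul_assoc]
      intro y
      rw [key, mul_one]
  · apply orderedMul_surjective _ _ _ (XN.adjoin_eq_top R N)
    rintro _ (⟨⟨a, i⟩, rfl⟩ | ⟨⟨a, i⟩, rfl⟩) x y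
    · exact ⟨(gen R a i * x) ⊗ₜ y, by simp [orderedMul_tmul, mul_assoc]⟩
    · have := passes_of_generators (createHom R N) (wickRep hR a)
        (withOne (annihilate R a)) _ (adjoin_gen R (Fin N)) (by
          rintro _ ⟨⟨b, n⟩, rfl⟩ (_ | j)
          · simp [Fintype.sum_option, withOne, wickRep_gen, wickMatrix_none_none,
              wickMatrix_none_some]
          · simp only [createHom_gen, Fintype.sum_option, withOne, Option.elim_none,
              Option.elim_some, annihilate_mul_create, wickRep_gen, wickMatrix_some_none,
              wickMatrix_some_some, map_sum, map_smul, Finset.sum_mul, smul_mul_assoc, mul_one]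
            rw [add_comm, Finset.sum_comm]
            congr 1
            split_ifs <;> simp) x (some i)
      refine ⟨∑ r, wickRep hR a x (some i) r ⊗ₜ (withOne (gen (dual R) a) r * y), ?_⟩
      have hq : ∀ r, annihilateHom R N (withOne (gen (dual R) a) r) =
          withOne (annihilate R a) r := by
        rintro (_ | r) <;> simp [withOne]
      simp only [map_sum, orderedMul_tmul, map_mul, hq, ← mul_assoc, ← Finset.sum_mul, ← this]
      rfl

theorem rank_XN (hR : IsRMatrix R) (N : ℕ) :
    Module.rank ℂ (XN R N) = Module.rank ℂ (X R) ^ N := by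
  have h : ∀ n, Module.rank ℂ (XN R n) =
      Module.rank ℂ (ModeAlg R (Fin n)) * Module.rank ℂ (ModeAlg (dual R) (Fin n)) := fun n => by
    rw [← (LinearEquiv.ofBijective _ (normalOrder_bijective hR n)).rank_eq, rank_tensorProduct']
  rw [h, h, rank_fin hR, rank_fin hR.dual, mul_pow]

/-- Only ranks are compared: the tensor power has a basis indexed by functions from `Fin N` to a
basis of `X R`, of cardinality `Module.rank ℂ (X R) ^ N`. -/
theorem nonempty_linearEquiv_piTensorProduct (hR : IsRMatrix R) (N : ℕ) :
    Nonempty (XN R N ≃ₗ[ℂ] ⨂[ℂ] _a : Fin N, X R) := by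
  let b := Module.Free.chooseBasis ℂ (X R)
  let c := Basis.piTensorProduct fun _ : Fin N => b
  have h : Module.rank ℂ (XN R N) =
      Module.rank ℂ ((Fin N → Module.Free.ChooseBasisIndex ℂ (X R)) →₀ ℂ) := by
    rw [rank_XN hR, ← b.mk_eq_rank'', rank_finsupp_self']
    simp
  obtain ⟨e⟩ := nonempty_linearEquiv_of_rank_eq h
  exact ⟨e.trans c.repr.symm⟩

/-- The homomorphism from the single-mode algebra that inserts the mode `a`. -/
noncomputable def modeHom (R : Tensor4 m) (a : Fin N) : X R →ₐ[ℂ] XN R N :=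
  XN.lift (fun _ => create R a) (fun _ => annihilate R a)
    (fun b c i j => by simp [annihilate_mul_create, Subsingleton.elim b c])
    (fun _ _ => create_mul_create R a a) (fun _ _ => annihilate_mul_annihilate R a a)

theorem modeHom_create (a : Fin N) (b : Fin 1) (i : Fin m) :
    modeHom R a (create R b i) = create R a i :=
  XN.lift_create _ _ _ _ _ b i

theorem modeHom_annihilate (a : Fin N) (b : Fin 1) (i : Fin m) :
    modeHom R a (annihilate R b i) = annihilate R a i :=
  XN.lift_annihilate _ _ _ _ _ b i

/-- Collapsing all modes to one respects the creation relations and the annihilation relations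
separately, but not in general the contraction `δ_ab`. The retraction `π` is therefore taken on
normally ordered tensors, not on `XN R N`. -/
theorem modeHom_injective (hR : IsRMatrix R) (a : Fin N) :
    Function.Injective (modeHom R a) := by
  have hleft : Function.LeftInverse (fun _ : Fin N => (0 : Fin 1)) fun _ => a :=
    fun _ => Subsingleton.elim _ _
  let ι := TensorProduct.map (map (S := R) fun _ : Fin 1 => a).toLinearMap
    (map (S := dual R) fun _ : Fin 1 => a).toLinearMap
  let π := TensorProduct.map (map (S := R) fun _ : Fin N => (0 : Fin 1)).toLinearMap
    (map (S := dual R) fun _ : Fin N => (0 : Fin 1)).toLinearMap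
  have hι : Function.Injective ι := by
    refine Function.LeftInverse.injective (g := π) fun z => ?_
    induction z with
    | zero => simp
    | add z w hz hw => rw [map_add, map_add, hz, hw]
    | tmul x y => simp [ι, π, map_leftInverse hleft x, map_leftInverse hleft y]
  have hc : (modeHom R a).comp (createHom R 1) =
      (createHom R N).comp (map fun _ : Fin 1 => a) :=
    hom_ext fun b i => by simp [modeHom_create]
  have ha : (modeHom R a).comp (annihilateHom R 1) =
      (annihilateHom R N).comp (map fun _ : Fin 1 => a) :=
    hom_ext fun b i => by simp [modeHom_annihilate]
  have hcomm : ∀ z, modeHom R a (orderedMul (createHom R 1) (annihilateHom R 1) z) =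
      orderedMul (createHom R N) (annihilateHom R N) (ι z) := by
    intro z
    induction z with
    | zero => simp
    | add z w hz hw => simp only [map_add, hz, hw]
    | tmul x y =>
      have hx := DFunLike.congr_fun hc x
      have hy := DFunLike.congr_fun ha y
      simp only [AlgHom.comp_apply] at hx hy
      simp [orderedMul_tmul, ι, hx, hy]
  intro x y hxy
  obtain ⟨z, rfl⟩ := (normalOrder_bijective hR 1).2 x
  obtain ⟨w, rfl⟩ := (normalOrder_bijective hR 1).2 y
  rw [hcomm, hcomm] at hxy
  rw [hι ((normalOrder_bijective hR N).1 hxy)]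

theorem modeHom_range (R : Tensor4 m) (a : Fin N) : (modeHom R a).range = modeSubalgebra R a := by
  rw [← Algebra.map_top, ← XN.adjoin_eq_top R 1, AlgHom.map_adjoin, Set.image_union,
    ← Set.range_comp, ← Set.range_comp, modeSubalgebra]
  congr 2
  · ext x
    simp [modeHom_create]
  · ext x
    simp [modeHom_annihilate]

end Fock

end Para

theorem lemma2 {m : ℕ} (R : Para.Tensor4 m) (hR : Para.IsRMatrix R) (N : ℕ) :
    Nonempty (Para.XN R N ≃ₗ[ℂ] ⨂[ℂ] _a : Fin N, Para.X R) ∧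
    ∀ a : Fin N, ∃ e : Para.X R ≃ₐ[ℂ] Para.modeSubalgebra R a,
      (∀ i : Fin m, (e (Para.create R 0 i) : Para.XN R N) = Para.create R a i) ∧
      (∀ i : Fin m, (e (Para.annihilate R 0 i) : Para.XN R N) = Para.annihilate R a i) := by
  refine ⟨Para.nonempty_linearEquiv_piTensorProduct hR N, fun a => ?_⟩
  let e := (AlgEquiv.ofInjective (Para.modeHom R a) (Para.modeHom_injective hR a)).trans
    (Subalgebra.equivOfEq _ _ (Para.modeHom_range R a))
  exact ⟨e, fun i => Para.modeHom_create a 0 i, fun i => Para.modeHom_annihilate a 0 i⟩
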